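/- Let $d,d'\in\mathbb N$, let $(A_{ir})_{1\le i\le d,\,1\le r\le d'}$ and $b_1,\dots,b_d$ be square-integrable real random variables on a common probability space, and let $\pi(i,r)\in\{1,\dots,d\}$ for all $i,r$. For probability distributions $\mu_1,\dots,\mu_d$ on $\mathbb R$ set $T(\mu_1,\dots,\mu_d):=(T_1(\mu_1,\dots,\mu_d),\dots,T_d(\mu_1,\dots,\mu_d))$, where $$T_i(\mu_1,\dots,\mu_d):=\mathcal L\Bigl(\sum_{r=1}^{d'}A_{ir}Z_{ir}+b_i\Bigr),$$ with $(A_{i1},\dots,A_{id'},b_i),Z_{i1},\dots,Z_{id'}$ independent and $Z_{ir}$ distributed as $\mu_{\pi(i,r)}$. Let $\mathcal M_2^{\mathbb R}(0)$ be the set of probability distributions on $\mathbb R$ with finite second moment and mean $0$, and let $(\mathcal M_2^{\mathbb R}(0))^{\times d}$ be its $d$-fold cartesian product. For $\mu,\nu\in(\mathcal M_2^{\mathbb R}(0))^{\times d}$ let $$\zeta_2^\vee(\mu,\nu):=\max_{1\le i\le d}\ \sup_{f\in\mathcal F_2}\Bigl|\int f\,d\mu_i-\int f\,d\nu_i\Bigr|,$$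 where $\mathcal F_2$ is the set of all $f\in C^1(\mathbb R,\mathbb R)$ with $|f'(x)-f'(y)|\le|x-y|$ for all $x,y\in\mathbb R$. Assume that $\mathbb E[b_i]=0$ for all $i$ and that $$q:=\max_{1\le i\le d}\sum_{r=1}^{d'}\mathbb E[A_{ir}^2]<1.$$ Then $T$ maps $(\mathcal M_2^{\mathbb R}(0))^{\times d}$ into itself; for all $\mu,\nu\in(\mathcal M_2^{\mathbb R}(0))^{\times d}$ one has $\zeta_2^\vee(\mu,\nu)<\infty$ and $\zeta_2^\vee(T(\mu),T(\nu))\le q\,\zeta_2^\vee(\mu,\nu)$; and $T$ has exactly one fixed point in $(\mathcal M_2^{\mathbb R}(0))^{\times d}$. -/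

import Mathlib

open MeasureTheory

noncomputable section

namespace UrnFixedPoint

/-- The centred probability distributions on the real line with finite second moment. -/
def M2Centered : Set (ProbabilityMeasure ℝ) :=
  {μ | MemLp (fun x : ℝ => x) 2 (μ : Measure ℝ) ∧ ∫ x, x ∂(μ : Measure ℝ) = 0}

/-- The `d`-fold cartesian product of `M2Centered`. -/
def M2CenteredProd (d : ℕ) : Set (Fin d → ProbabilityMeasure ℝ) :=
  {μ | ∀ i, μ i ∈ M2Centered}

/-- The test functions for the Zolotarev metric of order two: continuously differentiable
functions whose derivative is Lipschitz with constant one. -/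
def zolotarevClass2 : Set (ℝ → ℝ) :=
  {f | ContDiff ℝ 1 f ∧ ∀ x y, |deriv f x - deriv f y| ≤ |x - y|}

/-- The Zolotarev distance of order two, with values in `[0, ∞]`. It is used only between
distributions with finite second moment, for which every test function is integrable. -/
def zeta2 (μ ν : ProbabilityMeasure ℝ) : ENNReal :=
  ⨆ f ∈ zolotarevClass2,
    ENNReal.ofReal |∫ x, f x ∂(μ : Measure ℝ) - ∫ x, f x ∂(ν : Measure ℝ)|

/-- The maximum over the components of the Zolotarev distance of order two. -/
def zeta2Max {d : ℕ} (μ ν : Fin d → ProbabilityMeasure ℝ) : ENNReal :=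
  ⨆ i, zeta2 (μ i) (ν i)

variable {Ω : Type*} [MeasurableSpace Ω]

/-- For one row: the random variable `∑ r, A r * Z r + b`, on the product space on which the
coefficients depend on the first coordinate and `Z r` is a coordinate of the second one. -/
def affineSum {d' : ℕ} (A : Fin d' → Ω → ℝ) (b : Ω → ℝ) (p : Ω × (Fin d' → ℝ)) : ℝ :=
  ∑ r, A r p.1 * p.2 r + b p.1

theorem aemeasurable_affineSum {d' : ℕ} {P : Measure Ω} {A : Fin d' → Ω → ℝ} {b : Ω → ℝ}
    (hA : ∀ r, AEMeasurable (A r) P) (hb : AEMeasurable b P)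
    (Q : Measure (Fin d' → ℝ)) [SFinite Q] :
    AEMeasurable (affineSum A b) (P.prod Q) := by
  unfold affineSum
  refine AEMeasurable.add (Finset.aemeasurable_fun_sum _ fun r _ => ?_) hb.comp_fst
  exact (hA r).comp_fst.mul ((measurable_pi_apply r).comp measurable_snd).aemeasurable

/-- The map `T` on `d`-tuples of distributions. Its component `i` at `μ` is the law of
`∑ r, A i r * Z r + b i`, where the coefficient vector `(A i 1, ..., A i d', b i)` and
`Z 1, ..., Z d'` are independent (hence the product measure) and `Z r` has law `μ (π i r)`. -/
def T {d d' : ℕ} (P : Measure Ω) [IsProbabilityMeasure P]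
    (A : Fin d → Fin d' → Ω → ℝ) (b : Fin d → Ω → ℝ) (π : Fin d → Fin d' → Fin d)
    (hA : ∀ i r, AEMeasurable (A i r) P) (hb : ∀ i, AEMeasurable (b i) P)
    (μ : Fin d → ProbabilityMeasure ℝ) : Fin d → ProbabilityMeasure ℝ := fun i =>
  ⟨(P.prod (Measure.pi fun r => (μ (π i r) : Measure ℝ))).map (affineSum (A i) (b i)),
    Measure.isProbabilityMeasure_map (aemeasurable_affineSum (hA i) (hb i) _)⟩

end UrnFixedPoint

end

open Filter Topology

namespace UrnFixedPoint

/-! Contraction: the class `zolotarevClass2` is stable under `f ↦ a⁻² f(a · + β)`, so scaling by `a`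
multiplies `zeta2` by at most `a²`. Conditionally on the coefficients, replacing the `Z r` one at a
time costs `∑ r, a r ^ 2 * c` (`abs_integral_sub_pi_le`); integrating over the coefficients turns
this into the factor `q < 1`. Uniqueness follows, as `zeta2` separates points.

Existence needs no completeness of `zeta2`. Since `sin` and `cos` are test functions, `zeta2` bounds
characteristic functions with a factor `2 t²`. Along the iterates of `T` from the Dirac mass at `0`
they are thus Cauchy at each `t`, with a limit `φ` satisfying `|φ t - 1| ≤ C t²`. This one bound
gives continuity at `0`, hence a limit law by tightness, and also shows that this law is centred
with finite second moment. `T` respects pointwise convergence of characteristic functions, so the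
limit is fixed. -/

/-! ### Quadratic growth of test functions and finiteness of `zeta2` -/

theorem abs_sub_linear_le_sq {f : ℝ → ℝ} (hf : f ∈ zolotarevClass2) (x : ℝ) :
    |f x - f 0 - deriv f 0 * x| ≤ x ^ 2 := by
  have hd : Differentiable ℝ f := hf.1.differentiable (by norm_num)
  -- Mean value inequality on `[-|x|, |x|]`, where the derivative of `f y - f'(0) y` is at most
  -- `|x|`; the sharp factor 1/2 is not needed.
  have key := (convex_Icc (-|x|) |x|).norm_image_sub_le_of_norm_hasDerivWithin_le
    (f := fun y => f y - deriv f 0 * y) (f' := fun y => deriv f y - deriv f 0 * 1)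
    (C := |x|) (x := 0) (y := x)
    (fun y _ => ((hd y).hasDerivAt.sub ((hasDerivAt_id y).const_mul _)).hasDerivWithinAt)
    (fun y hy => by
      have h := hf.2 y 0
      rw [mul_one, Real.norm_eq_abs]
      exact h.trans (by simpa using abs_le.2 hy))
    (by simp) (abs_le.1 le_rfl)
  simp only [mul_zero, sub_zero, Real.norm_eq_abs, abs_mul_abs_self] at key
  rw [sq]
  convert key using 2
  ring

theorem integrable_comp_of_mem_zolotarevClass2 {α : Type*} [MeasurableSpace α] {ρ : Measure α}
    [IsFiniteMeasure ρ] {f : ℝ → ℝ} (hf : f ∈ zolotarevClass2) {X : α → ℝ} (hX : MemLp X 2 ρ) :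
    Integrable (fun a => f (X a)) ρ := by
  have h1 : Integrable X ρ := hX.integrable (by norm_num)
  have h2 : Integrable (fun a => X a ^ 2) ρ := hX.integrable_sq
  refine (((integrable_const |f 0|).add (h1.abs.const_mul |deriv f 0|)).add h2).mono'
    (hf.1.continuous.comp_aestronglyMeasurable hX.1) (ae_of_all _ fun a => ?_)
  have h := abs_sub_linear_le_sq hf (X a)
  simp only [Pi.add_apply, Real.norm_eq_abs]
  rw [← abs_mul]
  have h3 : f (X a) = (f (X a) - f 0 - deriv f 0 * X a) + (f 0 + deriv f 0 * X a) := by ring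
  have h4 := abs_add_le (f (X a) - f 0 - deriv f 0 * X a) (f 0 + deriv f 0 * X a)
  rw [← h3] at h4
  have h5 := abs_add_le (f 0) (deriv f 0 * X a)
  linarith

/-- Centring removes the linear Taylor term, whose slope is not controlled uniformly over the test
functions. -/
theorem abs_integral_sub_apply_zero_le {μ : ProbabilityMeasure ℝ} (hμ : μ ∈ M2Centered)
    {f : ℝ → ℝ} (hf : f ∈ zolotarevClass2) :
    |∫ x, f x ∂(μ : Measure ℝ) - f 0| ≤ ∫ x, x ^ 2 ∂(μ : Measure ℝ) := by
  have hfi := integrable_comp_of_mem_zolotarevClass2 hf hμ.1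
  have hi : Integrable (fun x : ℝ => x) (μ : Measure ℝ) := hμ.1.integrable (by norm_num)
  have h : ∫ x, f x ∂(μ : Measure ℝ) - f 0
      = ∫ x, (f x - f 0 - deriv f 0 * x) ∂(μ : Measure ℝ) := by
    rw [integral_sub (f := fun x => f x - f 0) (hfi.sub (integrable_const _)) (hi.const_mul _),
      integral_sub hfi (integrable_const _), integral_const_mul, hμ.2]
    simp
  rw [h, ← Real.norm_eq_abs]
  exact norm_integral_le_of_norm_le hμ.1.integrable_sq
    (ae_of_all _ fun x => abs_sub_linear_le_sq hf x)

theorem zeta2_le_ofReal_iff {μ ν : ProbabilityMeasure ℝ} {c : ℝ} (hc : 0 ≤ c) :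
    zeta2 μ ν ≤ ENNReal.ofReal c ↔ ∀ f ∈ zolotarevClass2,
      |∫ x, f x ∂(μ : Measure ℝ) - ∫ x, f x ∂(ν : Measure ℝ)| ≤ c := by
  simp only [zeta2, iSup_le_iff, ENNReal.ofReal_le_ofReal_iff hc]

theorem zeta2_lt_top {μ ν : ProbabilityMeasure ℝ} (hμ : μ ∈ M2Centered) (hν : ν ∈ M2Centered) :
    zeta2 μ ν < ⊤ := by
  refine lt_of_le_of_lt ((zeta2_le_ofReal_iff
    (c := ∫ x, x ^ 2 ∂(μ : Measure ℝ) + ∫ x, x ^ 2 ∂(ν : Measure ℝ)) ?_).2 fun f hf => ?_)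
    ENNReal.ofReal_lt_top
  · exact add_nonneg (integral_nonneg fun x => sq_nonneg x) (integral_nonneg fun x => sq_nonneg x)
  · have h1 := abs_le.1 (abs_integral_sub_apply_zero_le hμ hf)
    have h2 := abs_le.1 (abs_integral_sub_apply_zero_le hν hf)
    exact abs_le.2 ⟨by linarith, by linarith⟩

/-! ### Scaling, and replacement of independent coordinates -/

theorem abs_integral_sub_comp_affine_le {μ ν : ProbabilityMeasure ℝ} {c : ℝ}
    (hc : ∀ f ∈ zolotarevClass2,
      |∫ x, f x ∂(μ : Measure ℝ) - ∫ x, f x ∂(ν : Measure ℝ)| ≤ c)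
    {f : ℝ → ℝ} (hf : f ∈ zolotarevClass2) (a β : ℝ) :
    |∫ x, f (a * x + β) ∂(μ : Measure ℝ) - ∫ x, f (a * x + β) ∂(ν : Measure ℝ)|
      ≤ a ^ 2 * c := by
  rcases eq_or_ne a 0 with rfl | ha
  · simp
  have ha2 : 0 < a ^ 2 := by positivity
  have hd : Differentiable ℝ f := hf.1.differentiable (by norm_num)
  have hg : (fun x => (a ^ 2)⁻¹ * f (a * x + β)) ∈ zolotarevClass2 := by
    refine ⟨contDiff_const.mul (hf.1.comp ((contDiff_const.mul contDiff_id).add contDiff_const)),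
      fun x y => ?_⟩
    have hder : ∀ x, deriv (fun x => (a ^ 2)⁻¹ * f (a * x + β)) x
        = (a ^ 2)⁻¹ * (deriv f (a * x + β) * (a * 1)) := fun x =>
      (((hd (a * x + β)).hasDerivAt.comp x
        (((hasDerivAt_id x).const_mul a).add_const β)).const_mul _).deriv
    rw [hder, hder]
    have h := hf.2 (a * x + β) (a * y + β)
    have e1 : (a ^ 2)⁻¹ * (deriv f (a * x + β) * (a * 1))
        - (a ^ 2)⁻¹ * (deriv f (a * y + β) * (a * 1))
        = a⁻¹ * (deriv f (a * x + β) - deriv f (a * y + β)) := by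
      field_simp
    have e2 : x - y = a⁻¹ * ((a * x + β) - (a * y + β)) := by field_simp; ring
    rw [e1, e2, abs_mul, abs_mul]
    exact mul_le_mul_of_nonneg_left h (abs_nonneg _)
  have h := hc _ hg
  rw [integral_const_mul, integral_const_mul, ← mul_sub, abs_mul, abs_of_pos (inv_pos.2 ha2),
    inv_mul_le_iff₀ ha2] at h
  exact h

theorem memLp_sum_mul_add {α ι : Type*} [MeasurableSpace α] [Fintype ι] {ρ : Measure α}
    [IsFiniteMeasure ρ] (a : ι → ℝ) (β : ℝ) {X : ι → α → ℝ} (hX : ∀ r, MemLp (X r) 2 ρ) :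
    MemLp (fun z => ∑ r, a r * X r z + β) 2 ρ :=
  (memLp_finsetSum _ fun r _ => (hX r).const_mul (a r)).add (memLp_const β)

theorem memLp_eval_pi {n : ℕ} {μ : Fin n → ProbabilityMeasure ℝ}
    (hμ : ∀ r, MemLp (fun x : ℝ => x) 2 (μ r : Measure ℝ)) (r : Fin n) :
    MemLp (fun z : Fin n → ℝ => z r) 2 (Measure.pi fun r => (μ r : Measure ℝ)) :=
  (hμ r).comp_measurePreserving (measurePreserving_eval (fun r => (μ r : Measure ℝ)) r)

theorem integrable_comp_cons {n : ℕ} {f : ℝ → ℝ} (hf : f ∈ zolotarevClass2)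
    {μ₀ : ProbabilityMeasure ℝ} {μ : Fin n → ProbabilityMeasure ℝ}
    (hμ₀ : MemLp (fun x : ℝ => x) 2 (μ₀ : Measure ℝ))
    (hμ : ∀ r, MemLp (fun x : ℝ => x) 2 (μ r : Measure ℝ)) (a₀ : ℝ) (a : Fin n → ℝ) (β : ℝ) :
    Integrable (fun p : ℝ × (Fin n → ℝ) => f (a₀ * p.1 + (∑ r, a r * p.2 r + β)))
      ((μ₀ : Measure ℝ).prod (Measure.pi fun r => (μ r : Measure ℝ))) :=
  integrable_comp_of_mem_zolotarevClass2 hf ((hμ₀.comp_fst _).const_mul a₀ |>.add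
    ((memLp_sum_mul_add a β (memLp_eval_pi hμ)).comp_snd _))

theorem integral_swap_comp_cons {n : ℕ} {f : ℝ → ℝ} (hf : f ∈ zolotarevClass2)
    {μ₀ : ProbabilityMeasure ℝ} {μ : Fin n → ProbabilityMeasure ℝ}
    (hμ₀ : MemLp (fun x : ℝ => x) 2 (μ₀ : Measure ℝ))
    (hμ : ∀ r, MemLp (fun x : ℝ => x) 2 (μ r : Measure ℝ)) (a₀ : ℝ) (a : Fin n → ℝ) (β : ℝ) :
    ∫ x, ∫ z, f (a₀ * x + (∑ r, a r * z r + β)) ∂(Measure.pi fun r => (μ r : Measure ℝ))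
        ∂(μ₀ : Measure ℝ)
      = ∫ z, ∫ x, f (a₀ * x + (∑ r, a r * z r + β)) ∂(μ₀ : Measure ℝ)
          ∂(Measure.pi fun r => (μ r : Measure ℝ)) := by
  have h := integrable_comp_cons hf hμ₀ hμ a₀ a β
  exact (integral_prod _ h).symm.trans (integral_prod_symm _ h)

theorem integral_pi_succ_comp {n : ℕ} {f : ℝ → ℝ} (hf : f ∈ zolotarevClass2)
    {μ : Fin (n + 1) → ProbabilityMeasure ℝ}
    (hμ : ∀ r, MemLp (fun x : ℝ => x) 2 (μ r : Measure ℝ)) (a : Fin (n + 1) → ℝ) (β : ℝ) :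
    ∫ z, f (∑ r, a r * z r + β) ∂(Measure.pi fun r => (μ r : Measure ℝ))
      = ∫ x, ∫ z, f (a 0 * x + (∑ r, a (Fin.succ r) * z r + β))
          ∂(Measure.pi fun r => (μ (Fin.succ r) : Measure ℝ)) ∂(μ 0 : Measure ℝ) := by
  have mp := measurePreserving_piFinSuccAbove (fun r => (μ r : Measure ℝ)) 0
  simp only [Fin.zero_succAbove] at mp
  rw [← integral_prod _ (integrable_comp_cons hf (hμ 0) (fun r => hμ (Fin.succ r)) _ _ _)]
  rw [← mp.integral_comp' (fun p : ℝ × (Fin n → ℝ) =>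
    f (a 0 * p.1 + (∑ r, a (Fin.succ r) * p.2 r + β)))]
  refine integral_congr_ae (ae_of_all _ fun z => ?_)
  simp [Fin.sum_univ_succ, add_assoc, MeasurableEquiv.piFinSuccAbove, Fin.insertNthEquiv,
    Fin.tail]

/-- Hybrid argument: the intermediate law keeps `μ 0` and takes the other coordinates from `ν`. -/
theorem abs_integral_sub_pi_le {f : ℝ → ℝ} (hf : f ∈ zolotarevClass2) {c : ℝ} {n : ℕ}
    {μ ν : Fin n → ProbabilityMeasure ℝ}
    (hμ : ∀ r, MemLp (fun x : ℝ => x) 2 (μ r : Measure ℝ))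
    (hν : ∀ r, MemLp (fun x : ℝ => x) 2 (ν r : Measure ℝ))
    (hc : ∀ r, ∀ f ∈ zolotarevClass2,
      |∫ x, f x ∂(μ r : Measure ℝ) - ∫ x, f x ∂(ν r : Measure ℝ)| ≤ c)
    (a : Fin n → ℝ) (β : ℝ) :
    |∫ z, f (∑ r, a r * z r + β) ∂(Measure.pi fun r => (μ r : Measure ℝ))
      - ∫ z, f (∑ r, a r * z r + β) ∂(Measure.pi fun r => (ν r : Measure ℝ))|
      ≤ ∑ r, a r ^ 2 * c := by
  induction n generalizing β with
  | zero => simp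
  | succ n ih =>
    rw [integral_pi_succ_comp hf hμ, integral_pi_succ_comp hf hν, Fin.sum_univ_succ]
    have i1 := integrable_comp_cons hf (hμ 0) (fun r => hμ (Fin.succ r)) (a 0)
      (fun r => a (Fin.succ r)) β
    have i2 := integrable_comp_cons hf (hμ 0) (fun r => hν (Fin.succ r)) (a 0)
      (fun r => a (Fin.succ r)) β
    have i3 := integrable_comp_cons hf (hν 0) (fun r => hν (Fin.succ r)) (a 0)
      (fun r => a (Fin.succ r)) β
    refine (abs_sub_le _ (∫ x, ∫ z, f (a 0 * x + (∑ r, a (Fin.succ r) * z r + β))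
          ∂(Measure.pi fun r => (ν (Fin.succ r) : Measure ℝ)) ∂(μ 0 : Measure ℝ)) _).trans ?_
    rw [add_comm]
    refine add_le_add ?_ ?_
    -- Fubini makes coordinate `0` the inner variable; the rest of the sum is then a constant shift.
    · rw [integral_swap_comp_cons hf (hμ 0) fun r => hν (Fin.succ r),
        integral_swap_comp_cons hf (hν 0) fun r => hν (Fin.succ r),
        ← integral_sub i2.integral_prod_right i3.integral_prod_right, ← Real.norm_eq_abs]
      exact (norm_integral_le_of_norm_le_const (C := a 0 ^ 2 * c) (ae_of_all _ fun z =>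
        abs_integral_sub_comp_affine_le (hc 0) hf (a 0)
          (∑ r, a (Fin.succ r) * z r + β))).trans (by simp)
    · rw [← integral_sub i1.integral_prod_left i2.integral_prod_left, ← Real.norm_eq_abs]
      refine (norm_integral_le_of_norm_le_const (C := ∑ r : Fin n, a (Fin.succ r) ^ 2 * c)
        (ae_of_all _ fun x => ?_)).trans (by simp)
      have := ih (fun r => hμ (Fin.succ r)) (fun r => hν (Fin.succ r)) (fun r => hc (Fin.succ r))
        (fun r => a (Fin.succ r)) (a 0 * x + β)
      simpa only [add_left_comm, Real.norm_eq_abs] using this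

/-! ### Characteristic functions: comparison with `zeta2`, moments, limits -/

theorem sin_mem_zolotarevClass2 : Real.sin ∈ zolotarevClass2 :=
  ⟨Real.contDiff_sin, fun x y => by simpa using Real.abs_cos_sub_cos_le x y⟩

theorem cos_mem_zolotarevClass2 : Real.cos ∈ zolotarevClass2 :=
  ⟨Real.contDiff_cos, fun x y => by
    simpa [abs_sub_comm, neg_add_eq_sub] using Real.abs_sin_sub_sin_le x y⟩

theorem integrable_cexp_mul_I {α : Type*} [MeasurableSpace α] {ρ : Measure α}
    [IsFiniteMeasure ρ] {X : α → ℝ} (hX : AEMeasurable X ρ) (t : ℝ) :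
    Integrable (fun a => Complex.exp (t * X a * Complex.I)) ρ := by
  refine Integrable.of_bound (C := 1) ?_ (ae_of_all _ fun a => ?_)
  · have : Continuous fun x : ℝ => Complex.exp (t * x * Complex.I) := by fun_prop
    exact (this.measurable.comp_aemeasurable hX).aestronglyMeasurable
  · rw [← Complex.ofReal_mul, Complex.norm_exp_ofReal_mul_I]

theorem re_charFun (μ : ProbabilityMeasure ℝ) (t : ℝ) :
    (charFun (μ : Measure ℝ) t).re = ∫ x, Real.cos (t * x) ∂(μ : Measure ℝ) := by
  have h := integral_re (𝕜 := ℂ) (integrable_cexp_mul_I (aemeasurable_id (μ := (μ : Measure ℝ))) t)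
  rw [charFun_apply_real]
  refine Eq.trans h.symm (integral_congr_ae (ae_of_all _ fun x => ?_))
  simp only [id, RCLike.re_eq_complex_re]
  rw [← Complex.ofReal_mul, Complex.exp_ofReal_mul_I_re]

theorem im_charFun (μ : ProbabilityMeasure ℝ) (t : ℝ) :
    (charFun (μ : Measure ℝ) t).im = ∫ x, Real.sin (t * x) ∂(μ : Measure ℝ) := by
  have h := integral_im (𝕜 := ℂ) (integrable_cexp_mul_I (aemeasurable_id (μ := (μ : Measure ℝ))) t)
  rw [charFun_apply_real]
  refine Eq.trans h.symm (integral_congr_ae (ae_of_all _ fun x => ?_))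
  simp only [id, RCLike.im_eq_complex_im]
  rw [← Complex.ofReal_mul, Complex.exp_ofReal_mul_I_im]

theorem dist_charFun_le {μ ν : ProbabilityMeasure ℝ} {c : ℝ}
    (hc : ∀ f ∈ zolotarevClass2,
      |∫ x, f x ∂(μ : Measure ℝ) - ∫ x, f x ∂(ν : Measure ℝ)| ≤ c) (t : ℝ) :
    dist (charFun (μ : Measure ℝ) t) (charFun (ν : Measure ℝ) t) ≤ 2 * t ^ 2 * c := by
  rw [dist_eq_norm]
  refine (Complex.norm_le_abs_re_add_abs_im _).trans ?_
  rw [Complex.sub_re, Complex.sub_im, re_charFun, re_charFun, im_charFun, im_charFun]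
  have h1 := abs_integral_sub_comp_affine_le hc cos_mem_zolotarevClass2 t 0
  have h2 := abs_integral_sub_comp_affine_le hc sin_mem_zolotarevClass2 t 0
  simp only [add_zero] at h1 h2
  linarith

theorem eq_of_zeta2_eq_zero {μ ν : ProbabilityMeasure ℝ} (h : zeta2 μ ν = 0) : μ = ν := by
  have hc := (zeta2_le_ofReal_iff (μ := μ) (ν := ν) le_rfl).1 (by simp [h])
  refine Subtype.ext (Measure.ext_of_charFun (μ := (μ : Measure ℝ)) (ν := (ν : Measure ℝ))
    (funext fun t => ?_))
  exact dist_le_zero.1 ((dist_charFun_le hc t).trans (by simp))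

/-- Fatou's lemma for `(sin (s x) / s)² → x²` as `s → 0`; the half-angle formula expresses its
integral through the characteristic function at `2 s`. -/
theorem memLp_two_of_charFun {μ : ProbabilityMeasure ℝ} {C : ℝ}
    (h : ∀ t, ‖charFun (μ : Measure ℝ) t - 1‖ ≤ C * t ^ 2) :
    MemLp (fun x : ℝ => x) 2 (μ : Measure ℝ) := by
  let s : ℕ → ℝ := fun n => 1 / ((n : ℝ) + 1)
  have hs : ∀ n, 0 < s n := fun n => Nat.one_div_pos_of_nat
  have hs0 : Tendsto s atTop (𝓝[≠] 0) :=
    tendsto_nhdsWithin_iff.2 ⟨tendsto_one_div_add_atTop_nhds_zero_nat,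
      Eventually.of_forall fun n => (hs n).ne'⟩
  have hlim : ∀ x : ℝ, Tendsto (fun n => ENNReal.ofReal (((s n)⁻¹ * Real.sin (s n * x)) ^ 2)) atTop
      (𝓝 (ENNReal.ofReal (x ^ 2))) := fun x => by
    have hd : HasDerivAt (fun s : ℝ => Real.sin (s * x)) x 0 := by
      simpa using ((hasDerivAt_id (0 : ℝ)).mul_const x).sin
    have := hd.tendsto_slope_zero.comp hs0
    simp only [zero_add, zero_mul, Real.sin_zero, sub_zero, smul_eq_mul, Function.comp_def] at this
    exact ENNReal.tendsto_ofReal (this.pow 2)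
  have hbound : ∀ n, ∫⁻ x, ENNReal.ofReal (((s n)⁻¹ * Real.sin (s n * x)) ^ 2) ∂(μ : Measure ℝ)
      ≤ ENNReal.ofReal (2 * C) := fun n => by
    have hint : Integrable (fun x => Real.cos (2 * s n * x)) (μ : Measure ℝ) :=
      Integrable.of_bound (C := 1) (by fun_prop) (ae_of_all _ fun x => Real.abs_cos_le_one _)
    have e : ∀ x, ((s n)⁻¹ * Real.sin (s n * x)) ^ 2
        = (2 * s n ^ 2)⁻¹ * (1 - Real.cos (2 * s n * x)) := fun x => by
      have := Real.sin_sq_eq_half_sub (s n * x)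
      rw [mul_pow, this, ← mul_assoc 2]
      have := (hs n).ne'
      field_simp
    simp only [e]
    rw [← ofReal_integral_eq_lintegral_ofReal
      (f := fun x => (2 * s n ^ 2)⁻¹ * (1 - Real.cos (2 * s n * x)))
      (((integrable_const 1).sub hint).const_mul _)
      (ae_of_all _ fun x => (sq_nonneg _).trans_eq (e x)), integral_const_mul,
      integral_sub (integrable_const 1) hint, ← re_charFun]
    refine ENNReal.ofReal_le_ofReal ?_
    have h1 := (Complex.abs_re_le_norm _).trans (h (2 * s n))
    rw [Complex.sub_re, Complex.one_re] at h1
    have h2 := (abs_le.1 h1).1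
    have h3 : 0 < 2 * s n ^ 2 := by have := hs n; positivity
    rw [inv_mul_le_iff₀ h3]
    simp
    nlinarith
  rw [memLp_two_iff_integrable_sq (by fun_prop)]
  refine ⟨by fun_prop, (hasFiniteIntegral_iff_ofReal (ae_of_all _ fun x => sq_nonneg x)).2 ?_⟩
  calc ∫⁻ x, ENNReal.ofReal (x ^ 2) ∂(μ : Measure ℝ)
      = ∫⁻ x, liminf (fun n => ENNReal.ofReal (((s n)⁻¹ * Real.sin (s n * x)) ^ 2)) atTop
          ∂(μ : Measure ℝ) := lintegral_congr fun x => (hlim x).liminf_eq.symm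
    _ ≤ liminf (fun n => ∫⁻ x, ENNReal.ofReal (((s n)⁻¹ * Real.sin (s n * x)) ^ 2)
          ∂(μ : Measure ℝ)) atTop := lintegral_liminf_le fun n => by fun_prop
    _ ≤ ENNReal.ofReal (2 * C) :=
        liminf_le_of_le (by isBoundedDefault) fun b hb => by
          obtain ⟨n, hn⟩ := hb.exists
          exact hn.trans (hbound n)
    _ < ⊤ := ENNReal.ofReal_lt_top

theorem mem_M2Centered_of_charFun {μ : ProbabilityMeasure ℝ} {C : ℝ}
    (h : ∀ t, ‖charFun (μ : Measure ℝ) t - 1‖ ≤ C * t ^ 2) : μ ∈ M2Centered := by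
  have hL := memLp_two_of_charFun h
  refine ⟨hL, ?_⟩
  have hL1 : MemLp id ((1 : ℕ) : ENNReal) (μ : Measure ℝ) := by
    rw [Nat.cast_one]
    exact hL.mono_exponent (by norm_num)
  have h1 := iteratedDeriv_charFun_zero hL1
  have h0 : charFun (μ : Measure ℝ) 0 = 1 := by simp
  -- A quadratic bound forces derivative zero at `0`, and that derivative is `I` times the mean.
  have hO : (fun t => charFun (μ : Measure ℝ) t - 1) =O[𝓝 0] fun t => ‖t - 0‖ ^ 2 :=
    Asymptotics.IsBigO.of_bound C (Eventually.of_forall fun t => by simpa using h t)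
  have hd := (hO.hasFDerivAt (𝕜 := ℝ) (by norm_num)).hasDerivAt.deriv
  rw [iteratedDeriv_one] at h1
  rw [deriv_sub_const] at hd
  rw [hd] at h1
  simpa using h1.symm

/-- Lévy's continuity theorem. An ultrafilter limit in the compact closure replaces a convergent
subsequence; its characteristic function must be `φ`. -/
theorem exists_charFun_eq_of_tendsto {μ : ℕ → ProbabilityMeasure ℝ} {φ : ℝ → ℂ}
    (hφ : ContinuousAt φ 0)
    (h : ∀ t, Tendsto (fun n => charFun (μ n : Measure ℝ) t) atTop (𝓝 (φ t))) :
    ∃ ν : ProbabilityMeasure ℝ, ∀ t, charFun (ν : Measure ℝ) t = φ t := by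
  have h_tight : IsTightMeasureSet
      {x : Measure ℝ | ∃ ρ ∈ Set.range μ, (ρ : Measure ℝ) = x} := by
    simpa [Set.range] using isTightMeasureSet_of_tendsto_charFun hφ h
  have h_compact : IsCompact (closure (Set.range μ)) :=
    isCompact_closure_of_isTightMeasureSet h_tight
  have h_map : map μ (hyperfilter ℕ) ≤ 𝓟 (closure (Set.range μ)) :=
    le_principal_iff.2 (mem_map.2 (univ_mem' fun n => subset_closure ⟨n, rfl⟩))
  obtain ⟨ν, -, hν⟩ := h_compact.ultrafilter_le_nhds ((hyperfilter ℕ).map μ) h_map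
  replace hν : Tendsto μ (hyperfilter ℕ) (𝓝 ν) := hν
  rw [ProbabilityMeasure.tendsto_iff_forall_integral_rclike_tendsto ℂ] at hν
  have hch : ∀ t, Tendsto (fun n => charFun (μ n : Measure ℝ) t) (hyperfilter ℕ)
      (𝓝 (charFun (ν : Measure ℝ) t)) := fun t => by
    simp_rw [charFun_eq_integral_innerProbChar]
    exact hν (BoundedContinuousFunction.innerProbChar t)
  exact ⟨ν, fun t => tendsto_nhds_unique (hch t) ((h t).mono_left Nat.hyperfilter_le_atTop)⟩

/-! ### The map `T`: moments and contraction -/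

section
variable {Ω : Type*} [MeasurableSpace Ω] {P : Measure Ω} {d d' : ℕ}

theorem memLp_coeff_mul_eval {A : Ω → ℝ} (hA : MemLp A 2 P) {μ : Fin d' → ProbabilityMeasure ℝ}
    (hμ : ∀ r, MemLp (fun x : ℝ => x) 2 (μ r : Measure ℝ)) (r : Fin d') :
    MemLp (fun p : Ω × (Fin d' → ℝ) => A p.1 * p.2 r) 2
      (P.prod (Measure.pi fun r => (μ r : Measure ℝ))) := by
  have hZ := memLp_eval_pi hμ r
  refine (memLp_two_iff_integrable_sq (hA.1.comp_fst.mul hZ.1.comp_snd)).2 ?_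
  simpa only [Pi.mul_apply, mul_pow] using hA.integrable_sq.mul_prod hZ.integrable_sq

theorem memLp_affineSum {A : Fin d' → Ω → ℝ} {b : Ω → ℝ} (hA : ∀ r, MemLp (A r) 2 P)
    (hb : MemLp b 2 P) {μ : Fin d' → ProbabilityMeasure ℝ}
    (hμ : ∀ r, MemLp (fun x : ℝ => x) 2 (μ r : Measure ℝ)) :
    MemLp (affineSum A b) 2 (P.prod (Measure.pi fun r => (μ r : Measure ℝ))) :=
  (memLp_finsetSum _ fun r _ => memLp_coeff_mul_eval (hA r) hμ r).add (hb.comp_fst _)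

/-- Also covers `d = 0`, where the real supremum is `0`. -/
theorem iSup_sum_integral_sq_nonneg {A : Fin d → Fin d' → Ω → ℝ} :
    0 ≤ ⨆ i, ∑ r, ∫ ω, (A i r ω) ^ 2 ∂P :=
  Real.iSup_nonneg fun _ => Finset.sum_nonneg fun _ _ => integral_nonneg fun _ => sq_nonneg _

variable [IsProbabilityMeasure P]

theorem integral_affineSum_eq_zero {A : Fin d' → Ω → ℝ} {b : Ω → ℝ} (hA : ∀ r, MemLp (A r) 2 P)
    (hb : MemLp b 2 P) (hb0 : ∫ ω, b ω ∂P = 0) {μ : Fin d' → ProbabilityMeasure ℝ}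
    (hμ : ∀ r, μ r ∈ M2Centered) :
    ∫ p, affineSum A b p ∂(P.prod (Measure.pi fun r => (μ r : Measure ℝ))) = 0 := by
  have hi : ∀ r, Integrable (fun p : Ω × (Fin d' → ℝ) => A r p.1 * p.2 r)
      (P.prod (Measure.pi fun r => (μ r : Measure ℝ))) := fun r =>
    (memLp_coeff_mul_eval (hA r) (fun r => (hμ r).1) r).integrable (by norm_num)
  have hbi : Integrable b P := hb.integrable (by norm_num)
  unfold affineSum
  rw [integral_add (integrable_finsetSum _ fun r _ => hi r) (hbi.comp_fst _),
    integral_finsetSum _ fun r _ => hi r, integral_fun_fst, hb0, smul_zero, add_zero]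
  refine Finset.sum_eq_zero fun r _ => ?_
  rw [integral_prod_mul (A r) fun z : Fin d' → ℝ => z r,
    integral_comp_eval (μ := fun r => (μ r : Measure ℝ)) (i := r) (f := fun x => x)
      aestronglyMeasurable_id, (hμ r).2, mul_zero]

variable {A : Fin d → Fin d' → Ω → ℝ} {b : Fin d → Ω → ℝ} {π : Fin d → Fin d' → Fin d}
  {hA : ∀ i r, AEMeasurable (A i r) P} {hb : ∀ i, AEMeasurable (b i) P}

theorem integral_T {E : Type*} [NormedAddCommGroup E] [NormedSpace ℝ E] {f : ℝ → E}
    (hf : StronglyMeasurable f) (μ : Fin d → ProbabilityMeasure ℝ) (i : Fin d) :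
    ∫ x, f x ∂(T P A b π hA hb μ i : Measure ℝ)
      = ∫ p, f (affineSum (A i) (b i) p)
          ∂(P.prod (Measure.pi fun r => (μ (π i r) : Measure ℝ))) :=
  integral_map (aemeasurable_affineSum (hA i) (hb i) _) hf.aestronglyMeasurable

theorem T_mem_M2CenteredProd (hA2 : ∀ i r, MemLp (A i r) 2 P) (hb2 : ∀ i, MemLp (b i) 2 P)
    (hb0 : ∀ i, ∫ ω, b i ω ∂P = 0) {μ : Fin d → ProbabilityMeasure ℝ}
    (hμ : μ ∈ M2CenteredProd d) : T P A b π hA hb μ ∈ M2CenteredProd d := by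
  refine fun i => ⟨?_, ?_⟩
  · exact (memLp_map_measure_iff aestronglyMeasurable_id
      (aemeasurable_affineSum (hA i) (hb i) _)).2
        (memLp_affineSum (hA2 i) (hb2 i) fun r => (hμ (π i r)).1)
  · rw [integral_T (f := fun x => x) stronglyMeasurable_id]
    exact integral_affineSum_eq_zero (hA2 i) (hb2 i) (hb0 i) fun r => hμ (π i r)

theorem abs_integral_T_sub_le (hA2 : ∀ i r, MemLp (A i r) 2 P) (hb2 : ∀ i, MemLp (b i) 2 P)
    {μ ν : Fin d → ProbabilityMeasure ℝ} (hμ : μ ∈ M2CenteredProd d) (hν : ν ∈ M2CenteredProd d)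
    {c : ℝ} (hc : ∀ i, ∀ f ∈ zolotarevClass2,
      |∫ x, f x ∂(μ i : Measure ℝ) - ∫ x, f x ∂(ν i : Measure ℝ)| ≤ c)
    (i : Fin d) {f : ℝ → ℝ} (hf : f ∈ zolotarevClass2) :
    |∫ x, f x ∂(T P A b π hA hb μ i : Measure ℝ) - ∫ x, f x ∂(T P A b π hA hb ν i : Measure ℝ)|
      ≤ (⨆ i, ∑ r, ∫ ω, (A i r ω) ^ 2 ∂P) * c := by
  have hc0 : 0 ≤ c := (abs_nonneg _).trans (hc i f hf)
  have iμ := integrable_comp_of_mem_zolotarevClass2 hf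
    (memLp_affineSum (hA2 i) (hb2 i) fun r => (hμ (π i r)).1)
  have iν := integrable_comp_of_mem_zolotarevClass2 hf
    (memLp_affineSum (hA2 i) (hb2 i) fun r => (hν (π i r)).1)
  rw [integral_T hf.1.continuous.stronglyMeasurable, integral_T hf.1.continuous.stronglyMeasurable,
    integral_prod _ iμ, integral_prod _ iν,
    ← integral_sub iμ.integral_prod_left iν.integral_prod_left, ← Real.norm_eq_abs]
  have hsq : ∀ r, Integrable (fun ω => A i r ω ^ 2 * c) P := fun r =>
    (hA2 i r).integrable_sq.mul_const c
  refine (norm_integral_le_of_norm_le (integrable_finsetSum Finset.univ fun r _ => hsq r)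
    (ae_of_all _ fun ω => ?_)).trans ?_
  · exact abs_integral_sub_pi_le hf (fun r => (hμ (π i r)).1) (fun r => (hν (π i r)).1)
      (fun r => hc (π i r)) (fun r => A i r ω) (b i ω)
  · rw [integral_finsetSum _ fun r _ => hsq r]
    simp_rw [integral_mul_const]
    rw [← Finset.sum_mul]
    exact mul_le_mul_of_nonneg_right
      (le_ciSup (f := fun i => ∑ r, ∫ ω, (A i r ω) ^ 2 ∂P) (Set.finite_range _).bddAbove i) hc0

theorem zeta2Max_lt_top {μ ν : Fin d → ProbabilityMeasure ℝ} (hμ : μ ∈ M2CenteredProd d)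
    (hν : ν ∈ M2CenteredProd d) : zeta2Max μ ν < ⊤ := by
  refine lt_of_le_of_lt (iSup_le fun i => ?_)
    (ENNReal.sum_lt_top.2 fun i (_ : i ∈ Finset.univ) => zeta2_lt_top (hμ i) (hν i))
  exact Finset.single_le_sum (f := fun i => zeta2 (μ i) (ν i)) (fun _ _ => zero_le)
    (Finset.mem_univ i)

theorem abs_integral_sub_le_toReal_zeta2Max {μ ν : Fin d → ProbabilityMeasure ℝ}
    (h : zeta2Max μ ν ≠ ⊤) (i : Fin d) {f : ℝ → ℝ} (hf : f ∈ zolotarevClass2) :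
    |∫ x, f x ∂(μ i : Measure ℝ) - ∫ x, f x ∂(ν i : Measure ℝ)| ≤ (zeta2Max μ ν).toReal := by
  refine (zeta2_le_ofReal_iff ENNReal.toReal_nonneg).1 ?_ f hf
  rw [ENNReal.ofReal_toReal h]
  exact le_iSup (fun i => zeta2 (μ i) (ν i)) i

theorem zeta2Max_T_le (hA2 : ∀ i r, MemLp (A i r) 2 P) (hb2 : ∀ i, MemLp (b i) 2 P)
    {μ ν : Fin d → ProbabilityMeasure ℝ} (hμ : μ ∈ M2CenteredProd d)
    (hν : ν ∈ M2CenteredProd d) :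
    zeta2Max (T P A b π hA hb μ) (T P A b π hA hb ν)
      ≤ ENNReal.ofReal (⨆ i, ∑ r, ∫ ω, (A i r ω) ^ 2 ∂P) * zeta2Max μ ν := by
  have hfin := (zeta2Max_lt_top hμ hν).ne
  rw [← ENNReal.ofReal_toReal hfin, ← ENNReal.ofReal_mul iSup_sum_integral_sq_nonneg]
  exact iSup_le fun i => (zeta2_le_ofReal_iff
    (mul_nonneg iSup_sum_integral_sq_nonneg ENNReal.toReal_nonneg)).2 fun f hf =>
      abs_integral_T_sub_le hA2 hb2 hμ hν
        (fun i f hf => abs_integral_sub_le_toReal_zeta2Max hfin i hf) i hf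


/-! ### Existence and uniqueness of the fixed point -/

theorem charFun_T (μ : Fin d → ProbabilityMeasure ℝ) (i : Fin d) (t : ℝ) :
    charFun (T P A b π hA hb μ i : Measure ℝ) t
      = ∫ ω, Complex.exp (t * b i ω * Complex.I)
          * ∏ r, charFun (μ (π i r) : Measure ℝ) (t * A i r ω) ∂P := by
  have hc : Continuous fun x : ℝ => Complex.exp (t * x * Complex.I) := by fun_prop
  rw [charFun_apply_real, integral_T hc.stronglyMeasurable,
    integral_prod _ (integrable_cexp_mul_I (aemeasurable_affineSum (hA i) (hb i) _) t)]
  refine integral_congr_ae (ae_of_all _ fun ω => ?_)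
  have e : ∀ z : Fin d' → ℝ, Complex.exp (t * affineSum (A i) (b i) (ω, z) * Complex.I)
      = Complex.exp (t * b i ω * Complex.I)
        * ∏ r, Complex.exp ((t * A i r ω : ℝ) * z r * Complex.I) := fun z => by
    rw [← Complex.exp_sum, ← Complex.exp_add]
    congr 1
    simp only [affineSum]
    push_cast
    rw [← Finset.sum_mul, mul_add, Finset.mul_sum, add_mul, add_comm]
    simp only [mul_assoc]
  simp only [e]
  rw [integral_const_mul, integral_fintype_prod_eq_prod (μ := fun r => (μ (π i r) : Measure ℝ))
    fun r (x : ℝ) => Complex.exp ((t * A i r ω : ℝ) * x * Complex.I)]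
  simp only [charFun_apply_real]

theorem tendsto_charFun_T {μ : ℕ → Fin d → ProbabilityMeasure ℝ} {ν : Fin d → ProbabilityMeasure ℝ}
    (h : ∀ i t, Tendsto (fun n => charFun (μ n i : Measure ℝ) t) atTop
      (𝓝 (charFun (ν i : Measure ℝ) t))) (i : Fin d) (t : ℝ) :
    Tendsto (fun n => charFun (T P A b π hA hb (μ n) i : Measure ℝ) t) atTop
      (𝓝 (charFun (T P A b π hA hb ν i : Measure ℝ) t)) := by
  simp only [charFun_T]
  refine tendsto_integral_of_dominated_convergence (fun _ => 1) (fun n => ?_)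
    (integrable_const _) (fun n => ae_of_all _ fun ω => ?_) (ae_of_all _ fun ω => ?_)
  · have hc : Continuous fun x : ℝ => Complex.exp (t * x * Complex.I) := by fun_prop
    exact ((hc.measurable.comp_aemeasurable (hb i)).mul
      (Finset.aemeasurable_fun_prod _ fun r _ =>
        measurable_charFun.comp_aemeasurable ((hA i r).const_mul t))).aestronglyMeasurable
  · rw [norm_mul, ← Complex.ofReal_mul, Complex.norm_exp_ofReal_mul_I, one_mul, norm_prod]
    exact Finset.prod_le_one (fun _ _ => norm_nonneg _) fun _ _ => norm_charFun_le_one _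
  · exact (tendsto_finsetProd _ fun r _ => h (π i r) _).const_mul _

theorem dirac_zero_mem_M2CenteredProd :
    (fun _ => ⟨Measure.dirac 0, Measure.dirac.isProbabilityMeasure⟩) ∈ M2CenteredProd d :=
  fun _ => mem_M2Centered_of_charFun (C := 0) fun t => by simp

theorem exists_isFixedPt_T (hA2 : ∀ i r, MemLp (A i r) 2 P) (hb2 : ∀ i, MemLp (b i) 2 P)
    (hb0 : ∀ i, ∫ ω, b i ω ∂P = 0) (hq : (⨆ i, ∑ r, ∫ ω, (A i r ω) ^ 2 ∂P) < 1) :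
    ∃ μ ∈ M2CenteredProd d, Function.IsFixedPt (T P A b π hA hb) μ := by
  set q := ⨆ i, ∑ r, ∫ ω, (A i r ω) ^ 2 ∂P with hq_def
  let F := T P A b π hA hb
  let μ₀ : Fin d → ProbabilityMeasure ℝ :=
    fun _ => ⟨Measure.dirac 0, Measure.dirac.isProbabilityMeasure⟩
  have hmem : ∀ n, F^[n] μ₀ ∈ M2CenteredProd d := fun n => by
    induction n with
    | zero => exact dirac_zero_mem_M2CenteredProd
    | succ n ih =>
      rw [Function.iterate_succ_apply']
      exact T_mem_M2CenteredProd hA2 hb2 hb0 ih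
  let c := (zeta2Max μ₀ (F μ₀)).toReal
  have hstep : ∀ n i, ∀ f ∈ zolotarevClass2, |∫ x, f x ∂(F^[n] μ₀ i : Measure ℝ)
      - ∫ x, f x ∂(F^[n + 1] μ₀ i : Measure ℝ)| ≤ c * q ^ n := fun n => by
    induction n with
    | zero =>
      intro i f hf
      rw [pow_zero, mul_one]
      exact abs_integral_sub_le_toReal_zeta2Max (zeta2Max_lt_top (hmem 0) (hmem 1)).ne i hf
    | succ n ih =>
      intro i f hf
      rw [Function.iterate_succ_apply', Function.iterate_succ_apply' F (n + 1)]
      refine (abs_integral_T_sub_le hA2 hb2 (hmem n) (hmem (n + 1)) ih i hf).trans (le_of_eq ?_)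
      rw [← hq_def]
      ring
  have hdist : ∀ i t n, dist (charFun (F^[n] μ₀ i : Measure ℝ) t)
      (charFun (F^[n + 1] μ₀ i : Measure ℝ) t) ≤ 2 * t ^ 2 * c * q ^ n := fun i t n =>
    (dist_charFun_le (hstep n i) t).trans (le_of_eq (by ring))
  choose φ hφ using fun i t => cauchySeq_tendsto_of_complete
    (cauchySeq_of_le_geometric q _ hq (hdist i t))
  -- Summed geometric error from index `0`, where the characteristic function of the Dirac mass is
  -- `1`.
  have hφ1 : ∀ i t, ‖φ i t - 1‖ ≤ 2 * c / (1 - q) * t ^ 2 := fun i t => by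
    have h := dist_le_of_le_geometric_of_tendsto₀ q _ hq (hdist i t) (hφ i t)
    have h0 : charFun (F^[0] μ₀ i : Measure ℝ) t = 1 := by
      change charFun (Measure.dirac 0) t = 1
      simp
    rw [h0, dist_comm, dist_eq_norm] at h
    exact h.trans (le_of_eq (by ring))
  have hcont : ∀ i, ContinuousAt (φ i) 0 := fun i => by
    have h0 : φ i 0 = 1 := by simpa [sub_eq_zero] using hφ1 i 0
    rw [ContinuousAt, h0, tendsto_iff_norm_sub_tendsto_zero]
    refine squeeze_zero (fun _ => norm_nonneg _) (hφ1 i) ?_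
    have : Continuous fun t : ℝ => 2 * c / (1 - q) * t ^ 2 := by fun_prop
    simpa using this.tendsto 0
  choose ν hν using fun i => exists_charFun_eq_of_tendsto (hcont i) (hφ i)
  have hlim : ∀ i t, Tendsto (fun n => charFun (F^[n] μ₀ i : Measure ℝ) t) atTop
      (𝓝 (charFun (ν i : Measure ℝ) t)) := fun i t => by
    rw [hν]
    exact hφ i t
  have hfix : ∀ i, F ν i = ν i := fun i => Subtype.ext <|
      Measure.ext_of_charFun (μ := (F ν i : Measure ℝ)) (ν := (ν i : Measure ℝ)) <|
        funext fun t => by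
    refine tendsto_nhds_unique (tendsto_charFun_T hlim i t) ?_
    have := (tendsto_add_atTop_iff_nat 1).2 (hlim i t)
    simpa only [Function.iterate_succ_apply'] using this
  refine ⟨ν, fun i => mem_M2Centered_of_charFun (C := 2 * c / (1 - q)) fun t => ?_, funext hfix⟩
  rw [hν]
  exact hφ1 i t

theorem eq_of_isFixedPt_T (hA2 : ∀ i r, MemLp (A i r) 2 P) (hb2 : ∀ i, MemLp (b i) 2 P)
    (hq : (⨆ i, ∑ r, ∫ ω, (A i r ω) ^ 2 ∂P) < 1)
    {μ ν : Fin d → ProbabilityMeasure ℝ} (hμ : μ ∈ M2CenteredProd d) (hν : ν ∈ M2CenteredProd d)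
    (hμT : Function.IsFixedPt (T P A b π hA hb) μ) (hνT : Function.IsFixedPt (T P A b π hA hb) ν) :
    μ = ν := by
  have h := zeta2Max_T_le (π := π) (hA := hA) (hb := hb) hA2 hb2 hμ hν
  rw [hμT.eq, hνT.eq] at h
  -- Finiteness of the distance is essential: `z ≤ q z` with `q < 1` also holds for `z = ⊤` if `q >
  -- 0`.
  have h0 : zeta2Max μ ν = 0 := by
    by_contra hne
    refine absurd h (not_le.2 ?_)
    conv_rhs => rw [← one_mul (zeta2Max μ ν)]
    exact ENNReal.mul_lt_mul_left hne (zeta2Max_lt_top hμ hν).ne (ENNReal.ofReal_lt_one.2 hq)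
  exact funext fun i => eq_of_zeta2_eq_zero
    (le_antisymm ((le_iSup (fun i => zeta2 (μ i) (ν i)) i).trans h0.le) zero_le)

end

end UrnFixedPoint

theorem mainTheorem1 {Ω : Type*} [MeasurableSpace Ω] (P : Measure Ω) [IsProbabilityMeasure P]
    (d d' : ℕ) (A : Fin d → Fin d' → Ω → ℝ) (b : Fin d → Ω → ℝ)
    (π : Fin d → Fin d' → Fin d)
    (hA : ∀ i r, AEMeasurable (A i r) P) (hb : ∀ i, AEMeasurable (b i) P)
    (hA2 : ∀ i r, MemLp (A i r) 2 P) (hb2 : ∀ i, MemLp (b i) 2 P)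
    (hb0 : ∀ i, ∫ ω, b i ω ∂P = 0)
    (hcontr : (⨆ i, ∑ r, ∫ ω, (A i r ω) ^ 2 ∂P) < 1) :
    Set.MapsTo (UrnFixedPoint.T P A b π hA hb)
      (UrnFixedPoint.M2CenteredProd d) (UrnFixedPoint.M2CenteredProd d) ∧
    (∀ μ ∈ UrnFixedPoint.M2CenteredProd d, ∀ ν ∈ UrnFixedPoint.M2CenteredProd d,
      UrnFixedPoint.zeta2Max μ ν < ⊤ ∧
      UrnFixedPoint.zeta2Max (UrnFixedPoint.T P A b π hA hb μ) (UrnFixedPoint.T P A b π hA hb ν)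
        ≤ ENNReal.ofReal (⨆ i, ∑ r, ∫ ω, (A i r ω) ^ 2 ∂P) * UrnFixedPoint.zeta2Max μ ν) ∧
    ∃! μ : Fin d → ProbabilityMeasure ℝ,
      μ ∈ UrnFixedPoint.M2CenteredProd d ∧
        Function.IsFixedPt (UrnFixedPoint.T P A b π hA hb) μ := by
  refine ⟨fun μ hμ => UrnFixedPoint.T_mem_M2CenteredProd hA2 hb2 hb0 hμ,
    fun μ hμ ν hν => ⟨UrnFixedPoint.zeta2Max_lt_top hμ hν,
      UrnFixedPoint.zeta2Max_T_le hA2 hb2 hμ hν⟩, ?_⟩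
  obtain ⟨μ, hμ, hfix⟩ := UrnFixedPoint.exists_isFixedPt_T (π := π) (hA := hA) (hb := hb)
    hA2 hb2 hb0 hcontr
  exact ⟨μ, ⟨hμ, hfix⟩, fun ν hν =>
    UrnFixedPoint.eq_of_isFixedPt_T hA2 hb2 hcontr hν.1 hμ hν.2 hfix⟩
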